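/- Let $V$ be a finite-dimensional complex vector space and let $A$, $B$, $C$ be diagonalizable linear operators on $V$ with $A=B+C$. Suppose that for some ordering of the distinct eigenvalues $a_1,a_2$ of $A$, $b_1,b_2,\dots$ of $B$ and $c_1,c_2,\dots$ of $C$, their multiplicities form one of the following triples of compositions $(\alpha,\beta,\gamma)$ of $\dim V$, and that the corresponding inequalities hold (that is, the triple of spectra is a point of $S''(\alpha,\beta,\gamma)$): 1. (hypergeometric family) $(1,m-1),(1^m),(1^m)$ with $m\ge 2$; and $b_i+c_j-a_2\ne 0$ for all $1\le i,j\le m$; 2. (even family) $(m,m),(1,m-1,m),(1^{2m})$ with $m\ge 2$; and $c_i+b_3-a_1\ne0$, $c_i+b_3-a_2\neq 0$ for all $i$, and $c_i+c_j+b_2+b_3-a_1-a_2\ne 0$ for all $i\ne j$; 3. (odd family) $(m+1,m),(1,m,m),(1^{2m+1})$ with $m\ge 2$; and $c_i+b_3-a_1\ne0$, $c_i+b_2-a_1\ne 0$ for all $i$, and $c_i+c_j+b_2+b_3-a_1-a_2\ne 0$ for all $i\ne j$; 4. (extra case) $(4,2),(2,2,2),(1^6)$; and $b_i+c_j-a_1\ne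 0$ for all $1\le i\le 3$, $1\le j\le 6$, and $c_1+c_j+c_k-\frac12\sum_{l=1}^6c_l\neq 0$ for all $2\le j<k\le 6$. Here $(1^n)$ stands for $(1,\dots,1)$ with $n$ ones. Then a non-zero symmetric bilinear form on $V$ with respect to which $A$, $B$ and $C$ are self-adjoint is unique up to a constant multiple: if $f\ne 0$ and $g$ are symmetric bilinear forms on $V$ with respect to each of which $A$, $B$ and $C$ are self-adjoint, then $g=k f$ for some $k\in\mathbb{C}$. -/

import Mathlib

/-- The triples of spectral types (compositions) in Simpson's list. -/
inductive SimpsonType : Type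
  /-- The hypergeometric family `(1, m-1), (1^m), (1^m)`. -/
  | hypergeometric (m : ℕ) (hm : 2 ≤ m)
  /-- The even family `(m, m), (1, m-1, m), (1^(2m))`. -/
  | even (m : ℕ) (hm : 2 ≤ m)
  /-- The odd family `(m+1, m), (1, m, m), (1^(2m+1))`. -/
  | odd (m : ℕ) (hm : 2 ≤ m)
  /-- The extra case `(4, 2), (2, 2, 2), (1^6)`. -/
  | extra

namespace SimpsonType

/-- Number of parts of the spectral type of `B`. The spectral type of `A` always has two parts. -/
def lenB : SimpsonType → ℕ
  | hypergeometric m _ => m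
  | even _ _ => 3
  | odd _ _ => 3
  | extra => 3

/-- Number of parts of the spectral type of `C`. -/
def lenC : SimpsonType → ℕ
  | hypergeometric m _ => m
  | even m _ => 2 * m
  | odd m _ => 2 * m + 1
  | extra => 6

/-- The composition which is the spectral type of `A`. -/
def typeA : SimpsonType → Fin 2 → ℕ
  | hypergeometric m _ => ![1, m - 1]
  | even m _ => ![m, m]
  | odd m _ => ![m + 1, m]
  | extra => ![4, 2]

/-- The composition which is the spectral type of `B`. -/
def typeB : (t : SimpsonType) → Fin t.lenB → ℕ
  | hypergeometric _ _ => fun _ => 1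
  | even m _ => ![1, m - 1, m]
  | odd m _ => ![1, m, m]
  | extra => ![2, 2, 2]

/-- The composition which is the spectral type of `C`; it is always `(1, ..., 1)`. -/
def typeC (t : SimpsonType) : Fin t.lenC → ℕ := fun _ => 1

end SimpsonType

/-- Coordinates of a triple of spectra whose spectral types have `p`, `q`, `r` parts:
`a i`, `b i`, `c i` is the common value of the entries in the `i`-th block of the first, second,
third vector. Indices start at `0`, so that `a 0` is `a₁`, `a 1` is `a₂`, and so on. -/
@[ext]
structure TripleSpectrum (p q r : ℕ) where
  a : Fin p → ℂ
  b : Fin q → ℂ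
  c : Fin r → ℂ

/-- The set `S(α, β, γ)`: the values on different blocks are distinct, and the trace condition
holds. -/
def spectraOfType {p q r : ℕ} (α : Fin p → ℕ) (β : Fin q → ℕ) (γ : Fin r → ℕ) :
    Set (TripleSpectrum p q r) :=
  {s | Function.Injective s.a ∧ Function.Injective s.b ∧ Function.Injective s.c ∧
    ∑ i, (α i : ℂ) * s.a i = ∑ i, (β i : ℂ) * s.b i + ∑ i, (γ i : ℂ) * s.c i}

namespace SimpsonType

/-- The linear form `q_{ij} = c_i + c_j + b₂ + b₃ - a₁ - a₂` of the even and odd families. -/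
def qForm {r : ℕ} (s : TripleSpectrum 2 3 r) (i j : Fin r) : ℂ :=
  s.c i + s.c j + s.b 1 + s.b 2 - s.a 0 - s.a 1

/-- The linear form `c_i + c_j + c_k - (c₁ + ... + c₆) / 2` of the extra case. -/
noncomputable def qFormExtra (s : TripleSpectrum 2 3 6) (i j k : Fin 6) : ℂ :=
  s.c i + s.c j + s.c k - (∑ l, s.c l) / 2

/-- None of the linear forms occurring in the numerators and the denominators of the explicit
diagonal values `⟨vᵢ, vᵢ⟩` of the form in an eigenbasis (of `B` in the hypergeometric family, of `C`
in the other cases) vanishes at the given point. The differences of distinct eigenvalues also occur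
there, but these are nonzero on `S(α, β, γ)` already. -/
def AvoidsHyperplanes : (t : SimpsonType) → TripleSpectrum 2 t.lenB t.lenC → Prop
  | hypergeometric m _ => fun (s : TripleSpectrum 2 m m) =>
      ∀ i j : Fin m, s.b i + s.c j - s.a 1 ≠ 0
  | even m _ => fun (s : TripleSpectrum 2 3 (2 * m)) =>
      (∀ i : Fin (2 * m), s.c i + s.b 2 - s.a 0 ≠ 0 ∧ s.c i + s.b 2 - s.a 1 ≠ 0) ∧
      ∀ i j : Fin (2 * m), i ≠ j → qForm s i j ≠ 0
  | odd m _ => fun (s : TripleSpectrum 2 3 (2 * m + 1)) =>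
      (∀ i : Fin (2 * m + 1), s.c i + s.b 2 - s.a 0 ≠ 0 ∧ s.c i + s.b 1 - s.a 0 ≠ 0) ∧
      ∀ i j : Fin (2 * m + 1), i ≠ j → qForm s i j ≠ 0
  | extra => fun (s : TripleSpectrum 2 3 6) =>
      (∀ (i : Fin 3) (j : Fin 6), s.b i + s.c j - s.a 0 ≠ 0) ∧
      ∀ j k : Fin 6, 0 < j → j < k → qFormExtra s 0 j k ≠ 0

/-- The set `S''(α, β, γ)`, obtained from `S(α, β, γ)` by removing the hyperplanes above. -/
def genericSpectra (t : SimpsonType) : Set (TripleSpectrum 2 t.lenB t.lenC) :=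
  {s | s ∈ spectraOfType t.typeA t.typeB t.typeC ∧ t.AvoidsHyperplanes s}

end SimpsonType

/-- `T` is diagonalizable with spectral type `mult`, its spectrum (the multiset of eigenvalues)
consisting of `mult i` copies of `e i` for each `i`. -/
def HasDiagonalSpectrum {V : Type*} [AddCommGroup V] [Module ℂ V] [FiniteDimensional ℂ V]
    (T : Module.End ℂ V) {p : ℕ} (mult : Fin p → ℕ) (e : Fin p → ℂ) : Prop :=
  (⨆ μ : ℂ, T.eigenspace μ) = ⊤ ∧
    T.charpoly.roots = ∑ i, Multiset.replicate (mult i) (e i)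

/-- `f` is a symmetric bilinear form with respect to which `A`, `B` and `C` are self-adjoint. -/
def IsSelfAdjointForm {V : Type*} [AddCommGroup V] [Module ℂ V]
    (A B C : Module.End ℂ V) (f : LinearMap.BilinForm ℂ V) : Prop :=
  f.IsSymm ∧ (∀ v w, f (A v) w = f v (A w)) ∧ (∀ v w, f (B v) w = f v (B w)) ∧
    (∀ v w, f (C v) w = f v (C w))

open Module

/-! The inequalities force `A`, `B`, `C` to have no common invariant subspace except `0` and `V`.
Uniqueness is then Schur's lemma: self-adjointness makes kernels of the forms invariant, so `f` is
nondegenerate, and for an eigenvalue `k` of `f⁻¹g` the form `g - k f` has a nonzero kernel, hence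
vanishes.

For irreducibility, let `W` be invariant, nonzero and proper. Diagonalizability splits every
eigenspace dimension between `W` and `V/W`. If no `b_i + c_j` equals `a_l`, the `a_l`- and
`b_i`-eigenspaces meet trivially on both pieces (`finrank_add_le`); for the pairs used, their
dimensions on `V` add up to `dim V`, so both bounds are equalities. In the hypergeometric and extra
cases the eigenspaces of `B` on `W` then have equal dimensions: this is absurd in the former, and in
the latter it gives `dim W = 3`, excluded by a trace computation. In the even and odd families the
simple eigenvalue `b₁` is missing from one piece. There `A` and `B` are both quadratic, and `q_{ij}
≠ 0` makes them commute (`commute_A_B`), so an eigenspace already known to be nonzero must vanish.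
-/

/-- The eigenspaces of `T` for the eigenvalues `e i` span the whole space. -/
def DiagonalizedBy {U ι : Type*} [AddCommGroup U] [Module ℂ U] (T : End ℂ U) (e : ι → ℂ) : Prop :=
  ⨆ i, T.eigenspace (e i) = ⊤

/-! ### Diagonalizable operators, invariant subspaces and quotients. -/

namespace DiagonalizedBy

variable {U : Type*} [AddCommGroup U] [Module ℂ U] {ι : Type*} {T : End ℂ U} {e : ι → ℂ}

lemma of_forall_hasEigenvalue (h : ⨆ μ : ℂ, T.eigenspace μ = ⊤)
    (he : ∀ μ, T.HasEigenvalue μ → ∃ i, e i = μ) : DiagonalizedBy T e := by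
  refine eq_top_iff.2 (h.symm.le.trans (iSup_le fun μ => ?_))
  by_cases hμ : T.HasEigenvalue μ
  · obtain ⟨i, rfl⟩ := he μ hμ
    exact le_iSup (fun i => T.eigenspace (e i)) i
  · rw [End.hasEigenvalue_iff, not_not] at hμ
    exact hμ ▸ bot_le

lemma iSup_eigenspace (h : DiagonalizedBy T e) : ⨆ μ : ℂ, T.eigenspace μ = ⊤ :=
  eq_top_iff.2 (h.symm.le.trans (iSup_le fun i => le_iSup T.eigenspace (e i)))

lemma exists_eq_of_hasEigenvalue (h : DiagonalizedBy T e) {μ : ℂ} (hμ : T.HasEigenvalue μ) :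
    ∃ i, e i = μ := by
  by_contra! hne
  refine hμ ((T.eigenspaces_iSupIndep μ).eq_bot_of_le (le_top.trans (h.symm.le.trans ?_)))
  exact iSup_le fun i => le_iSup₂_of_le (e i) (hne i) le_rfl

/-- Modular law: the eigenspace and the larger generalized eigenspace share the sum of the other
generalized eigenspaces as a complement. -/
lemma maxGenEigenspace_eq_eigenspace (h : DiagonalizedBy T e) (μ : ℂ) :
    T.maxGenEigenspace μ = T.eigenspace μ := by
  symm
  refine eq_of_le_of_inf_le_of_sup_le (z := ⨆ ν, ⨆ _ : ν ≠ μ, T.maxGenEigenspace ν)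
    T.eigenspace_le_maxGenEigenspace ?_ ?_
  · exact (T.independent_maxGenEigenspace μ).le_bot.trans bot_le
  · refine le_top.trans (h.iSup_eigenspace.symm.le.trans (iSup_le fun ν => ?_))
    rcases eq_or_ne ν μ with rfl | hν
    · exact le_sup_left
    · exact le_sup_of_le_right
        (le_iSup₂_of_le ν hν (T.eigenspace_le_maxGenEigenspace (μ := ν)))

lemma mem_eigenspace_of_sub_mem (h : DiagonalizedBy T e) {μ : ℂ} {w : U}
    (hw : T w - μ • w ∈ T.eigenspace μ) : w ∈ T.eigenspace μ := by
  rw [← h.maxGenEigenspace_eq_eigenspace, End.mem_maxGenEigenspace]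
  refine ⟨2, ?_⟩
  rw [End.mem_eigenspace_iff] at hw
  simp [pow_two, hw]

lemma linearMap_ext (h : DiagonalizedBy T e) {X : Type*} [AddCommGroup X] [Module ℂ X]
    {φ ψ : U →ₗ[ℂ] X} (hφ : ∀ i, ∀ v ∈ T.eigenspace (e i), φ v = ψ v) : φ = ψ := by
  have : ⊤ ≤ LinearMap.eqLocus φ ψ := h.symm.le.trans (iSup_le fun i v hv => hφ i v hv)
  exact LinearMap.ext fun v => this (Submodule.mem_top (x := v))

lemma trace_eq [FiniteDimensional ℂ U] [Fintype ι] (h : DiagonalizedBy T e)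
    (he : Function.Injective e) :
    LinearMap.trace ℂ U T = ∑ i, (finrank ℂ (T.eigenspace (e i)) : ℂ) * e i := by
  classical
  have hint := DirectSum.isInternal_submodule_of_iSupIndep_of_iSup_eq_top
    (T.eigenspaces_iSupIndep.comp he) h
  rw [LinearMap.trace_eq_sum_trace_restrict hint
    (fun i v hv => End.mapsTo_genEigenspace_of_comm (Commute.refl T) _ _ hv)]
  refine Finset.sum_congr rfl fun i _ => ?_
  have : T.restrict (fun v hv => End.mapsTo_genEigenspace_of_comm (Commute.refl T) (e i) 1 hv)
      = e i • (LinearMap.id : T.eigenspace (e i) →ₗ[ℂ] T.eigenspace (e i)) := by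
    ext v
    simpa using End.mem_eigenspace_iff.1 v.2
  erw [this]
  simp [mul_comm]

lemma sum_finrank [FiniteDimensional ℂ U] [Fintype ι] (h : DiagonalizedBy T e)
    (he : Function.Injective e) :
    ∑ i, finrank ℂ (T.eigenspace (e i)) = finrank ℂ U := by
  classical
  have hint := DirectSum.isInternal_submodule_of_iSupIndep_of_iSup_eq_top
    (T.eigenspaces_iSupIndep.comp he) h
  have := LinearMap.trace_eq_sum_trace_restrict hint (f := LinearMap.id) (fun i v hv => hv)
  rw [LinearMap.trace_id] at this
  have h2 : ∀ i, LinearMap.trace ℂ _ ((LinearMap.id : U →ₗ[ℂ] U).restrict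
      (p := T.eigenspace (e i)) (fun v hv => hv)) = (finrank ℂ (T.eigenspace (e i)) : ℂ) :=
    fun i => LinearMap.trace_id ℂ _
  erw [Finset.sum_congr rfl fun i _ => h2 i] at this
  exact_mod_cast this.symm

variable {W : Submodule ℂ U}

lemma restrict [FiniteDimensional ℂ U] (h : DiagonalizedBy T e) (hW : ∀ v ∈ W, T v ∈ W) :
    DiagonalizedBy (T.restrict hW) e := by
  refine of_forall_hasEigenvalue (End.genEigenspace_restrict_eq_top hW h.iSup_eigenspace) ?_
  intro μ hμ
  obtain ⟨v, hv⟩ := hμ.exists_hasEigenvector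
  refine h.exists_eq_of_hasEigenvalue (End.hasEigenvalue_of_hasEigenvector (x := (v : U))
    ⟨End.mem_eigenspace_iff.2 ?_, by simpa using hv.2⟩)
  simpa using congrArg Subtype.val hv.apply_eq_smul

lemma map_mkQ_eigenspace_le (hW : W ≤ W.comap T) (μ : ℂ) :
    (T.eigenspace μ).map W.mkQ ≤ End.eigenspace (W.mapQ W T hW) μ := by
  rintro _ ⟨v, hv, rfl⟩
  rw [End.mem_eigenspace_iff]
  simp [End.mem_eigenspace_iff.1 hv]

lemma mapQ (h : DiagonalizedBy T e) (hW : W ≤ W.comap T) :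
    DiagonalizedBy (W.mapQ W T hW) e := by
  refine eq_top_iff.2 ?_
  calc (⊤ : Submodule ℂ (U ⧸ W)) = (⨆ i, T.eigenspace (e i)).map W.mkQ := by
        rw [show ⨆ i, T.eigenspace (e i) = ⊤ from h, Submodule.map_top, Submodule.range_mkQ]
    _ ≤ _ := by
      rw [Submodule.map_iSup]
      exact iSup_mono fun i => map_mkQ_eigenspace_le hW (e i)

/-- Rank-nullity for the projection of the eigenspace to `U ⧸ W`. -/
lemma finrank_eigenspace_le [FiniteDimensional ℂ U] (hW : ∀ v ∈ W, T v ∈ W)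
    (μ : ℂ) : finrank ℂ (T.eigenspace μ) ≤ finrank ℂ (End.eigenspace (T.restrict hW) μ) +
      finrank ℂ (End.eigenspace (W.mapQ W T hW) μ) := by
  let φ : T.eigenspace μ →ₗ[ℂ] U ⧸ W := W.mkQ.domRestrict (T.eigenspace μ)
  rw [← LinearMap.finrank_range_add_finrank_ker φ, add_comm]
  refine add_le_add ?_ (Submodule.finrank_mono ?_)
  · have hmem : ∀ x : LinearMap.ker φ, ((x : T.eigenspace μ) : U) ∈ W := fun x =>
      (Submodule.Quotient.mk_eq_zero W).1 (LinearMap.mem_ker.1 x.2)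
    let ψ : LinearMap.ker φ →ₗ[ℂ] End.eigenspace (T.restrict hW) μ :=
      { toFun := fun x => ⟨⟨x, hmem x⟩, End.mem_eigenspace_iff.2
          (Subtype.ext (End.mem_eigenspace_iff.1 x.1.2))⟩
        map_add' := fun _ _ => rfl
        map_smul' := fun _ _ => rfl }
    refine LinearMap.finrank_le_finrank_of_injective (f := ψ) fun x y hxy => ?_
    exact Subtype.ext (Subtype.ext (congrArg (fun z : End.eigenspace (T.restrict hW) μ => ((z : W) : U)) hxy))
  · rw [LinearMap.range_domRestrict]
    exact map_mkQ_eigenspace_le hW μ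

/-- Summed over all eigenvalues, both sides of `finrank_eigenspace_le` give `dim U`, so each
inequality is an equality. -/
lemma finrank_eigenspace_eq_add [FiniteDimensional ℂ U] [Fintype ι] (h : DiagonalizedBy T e)
    (he : Function.Injective e) (hW : ∀ v ∈ W, T v ∈ W) (i : ι) :
    finrank ℂ (T.eigenspace (e i)) = finrank ℂ (End.eigenspace (T.restrict hW) (e i)) +
      finrank ℂ (End.eigenspace (W.mapQ W T hW) (e i)) := by
  refine (Finset.sum_eq_sum_iff_of_le fun i _ => finrank_eigenspace_le hW (e i)).1 ?_ i
    (Finset.mem_univ i)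
  rw [Finset.sum_add_distrib, h.sum_finrank he, (h.restrict hW).sum_finrank he,
    (h.mapQ hW).sum_finrank he, add_comm, Submodule.finrank_quotient_add_finrank]

lemma mul_self_eq {x y : ℂ} (h : ⊤ ≤ T.eigenspace x ⊔ T.eigenspace y) :
    T * T = (x + y) • T - (x * y) • (1 : End ℂ U) := by
  have : ⊤ ≤ LinearMap.eqLocus (T * T) ((x + y) • T - (x * y) • (1 : End ℂ U)) := by
    refine h.trans (sup_le ?_ ?_) <;> intro v hv <;> rw [End.mem_eigenspace_iff] at hv <;>
      simp only [LinearMap.mem_eqLocus, End.mul_apply, hv, map_smul, LinearMap.sub_apply,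
        LinearMap.smul_apply, End.one_apply] <;> module
  exact LinearMap.ext fun v => this (Submodule.mem_top (x := v))

end DiagonalizedBy

/-! ### Eigenspace dimensions from the characteristic polynomial. -/

lemma HasDiagonalSpectrum.diagonalizedBy {V : Type*} [AddCommGroup V] [Module ℂ V]
    [FiniteDimensional ℂ V] {T : End ℂ V} {p : ℕ} {mult : Fin p → ℕ} {e : Fin p → ℂ}
    (h : HasDiagonalSpectrum T mult e) : DiagonalizedBy T e := by
  refine .of_forall_hasEigenvalue h.1 fun μ hμ => ?_
  rw [End.hasEigenvalue_iff_isRoot_charpoly,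
    ← Polynomial.mem_roots (LinearMap.charpoly_monic T).ne_zero, h.2, Multiset.mem_sum] at hμ
  obtain ⟨i, -, hi⟩ := hμ
  exact ⟨i, (Multiset.eq_of_mem_replicate hi).symm⟩

lemma HasDiagonalSpectrum.finrank_eigenspace {V : Type*} [AddCommGroup V] [Module ℂ V]
    [FiniteDimensional ℂ V] {T : End ℂ V} {p : ℕ} {mult : Fin p → ℕ} {e : Fin p → ℂ}
    (h : HasDiagonalSpectrum T mult e) (he : Function.Injective e) (i : Fin p) :
    finrank ℂ (T.eigenspace (e i)) = mult i := by
  rw [← h.diagonalizedBy.maxGenEigenspace_eq_eigenspace, LinearMap.finrank_maxGenEigenspace_eq,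
    ← Polynomial.count_roots, h.2, Multiset.count_sum']
  simp [Multiset.count_replicate, he.eq_iff]

/-! ### Triples with `A = B + C`; values in `s` need not occur as eigenvalues, so `s` serves for
subspaces and quotients too. -/

/-- `A = B + C`, and the three operators are diagonalized by the three families of distinct values
in `s`. -/
structure IsDiagonalTriple {U : Type*} [AddCommGroup U] [Module ℂ U] {p q r : ℕ}
    (A B C : End ℂ U) (s : TripleSpectrum p q r) : Prop where
  eq_add : A = B + C
  diagA : DiagonalizedBy A s.a
  diagB : DiagonalizedBy B s.b
  diagC : DiagonalizedBy C s.c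
  injA : Function.Injective s.a
  injB : Function.Injective s.b
  injC : Function.Injective s.c

namespace IsDiagonalTriple

variable {U : Type*} [AddCommGroup U] [Module ℂ U] {p q r : ℕ} {A B C : End ℂ U}
  {s : TripleSpectrum p q r} {W : Submodule ℂ U}

lemma restrict [FiniteDimensional ℂ U] (h : IsDiagonalTriple A B C s) (hA : ∀ v ∈ W, A v ∈ W)
    (hB : ∀ v ∈ W, B v ∈ W) (hC : ∀ v ∈ W, C v ∈ W) :
    IsDiagonalTriple (A.restrict hA) (B.restrict hB) (C.restrict hC) s where
  eq_add := LinearMap.ext fun v => Subtype.ext (LinearMap.congr_fun h.eq_add v)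
  diagA := h.diagA.restrict hA
  diagB := h.diagB.restrict hB
  diagC := h.diagC.restrict hC
  injA := h.injA
  injB := h.injB
  injC := h.injC

lemma mapQ (h : IsDiagonalTriple A B C s) (hA : W ≤ W.comap A)
    (hB : W ≤ W.comap B) (hC : W ≤ W.comap C) :
    IsDiagonalTriple (W.mapQ W A hA) (W.mapQ W B hB) (W.mapQ W C hC) s where
  eq_add := by
    refine Submodule.linearMap_qext _ (LinearMap.ext fun v => ?_)
    simp [h.eq_add]
  diagA := h.diagA.mapQ hA
  diagB := h.diagB.mapQ hB
  diagC := h.diagC.mapQ hC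
  injA := h.injA
  injB := h.injB
  injC := h.injC

/-- A common eigenvector of `A` and `B` would be an eigenvector of `C` with eigenvalue `a_l - b_i`.
-/
lemma disjoint_eigenspace (h : IsDiagonalTriple A B C s) {l : Fin p} {i : Fin q}
    (hli : ∀ j, s.c j + s.b i - s.a l ≠ 0) :
    Disjoint (A.eigenspace (s.a l)) (B.eigenspace (s.b i)) := by
  rw [Submodule.disjoint_def]
  intro v hA hB
  by_contra hv
  rw [End.mem_eigenspace_iff] at hA hB
  have hC : C v = (s.a l - s.b i) • v := by
    rw [h.eq_add, LinearMap.add_apply, hB] at hA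
    rw [sub_smul, ← hA, add_sub_cancel_left]
  obtain ⟨j, hj⟩ := h.diagC.exists_eq_of_hasEigenvalue
    (End.hasEigenvalue_of_hasEigenvector ⟨End.mem_eigenspace_iff.2 hC, hv⟩)
  exact hli j (by rw [hj]; ring)

lemma finrank_add_le [FiniteDimensional ℂ U] (h : IsDiagonalTriple A B C s) {l : Fin p}
    {i : Fin q} (hli : ∀ j, s.c j + s.b i - s.a l ≠ 0) :
    finrank ℂ (A.eigenspace (s.a l)) + finrank ℂ (B.eigenspace (s.b i)) ≤ finrank ℂ U :=
  Submodule.finrank_add_finrank_le_of_disjoint (h.disjoint_eigenspace hli)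

lemma trace_eq [FiniteDimensional ℂ U] (h : IsDiagonalTriple A B C s) :
    ∑ l, (finrank ℂ (A.eigenspace (s.a l)) : ℂ) * s.a l =
      ∑ i, (finrank ℂ (B.eigenspace (s.b i)) : ℂ) * s.b i +
        ∑ j, (finrank ℂ (C.eigenspace (s.c j)) : ℂ) * s.c j := by
  rw [← h.diagA.trace_eq h.injA, ← h.diagB.trace_eq h.injB, ← h.diagC.trace_eq h.injC,
    h.eq_add, map_add]

/-- The dimensions of the eigenspaces on an invariant subspace and on the quotient. -/
lemma exists_finrank_eq_add [FiniteDimensional ℂ U] (h : IsDiagonalTriple A B C s)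
    (hA : ∀ v ∈ W, A v ∈ W) (hB : ∀ v ∈ W, B v ∈ W) (hC : ∀ v ∈ W, C v ∈ W) :
    (∀ l, finrank ℂ (A.eigenspace (s.a l)) =
      finrank ℂ (End.eigenspace (A.restrict hA) (s.a l)) +
        finrank ℂ (End.eigenspace (W.mapQ W A hA) (s.a l))) ∧
    (∀ i, finrank ℂ (B.eigenspace (s.b i)) =
      finrank ℂ (End.eigenspace (B.restrict hB) (s.b i)) +
        finrank ℂ (End.eigenspace (W.mapQ W B hB) (s.b i))) ∧
    (∀ j, finrank ℂ (C.eigenspace (s.c j)) =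
      finrank ℂ (End.eigenspace (C.restrict hC) (s.c j)) +
        finrank ℂ (End.eigenspace (W.mapQ W C hC) (s.c j))) :=
  ⟨h.diagA.finrank_eigenspace_eq_add h.injA hA, h.diagB.finrank_eigenspace_eq_add h.injB hB,
    h.diagC.finrank_eigenspace_eq_add h.injC hC⟩

end IsDiagonalTriple

/-! ### Commutation forced by quadratic relations. -/

/-- `T` preserves the eigenspace of `S`, and `(T - y)(T - x) = 0`: for `v` in it, `(T - x) v` is a
`y`-eigenvector or zero, hence zero, and then so is `v`. -/
lemma eigenspace_eq_bot_of_commute {U : Type*} [AddCommGroup U] [Module ℂ U] {S T : End ℂ U}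
    (hST : Commute S T) {x y μ : ℂ} (hT : T * T = (x + y) • T - (x * y) • (1 : End ℂ U))
    (hx : Disjoint (S.eigenspace μ) (T.eigenspace x))
    (hy : Disjoint (S.eigenspace μ) (T.eigenspace y)) : S.eigenspace μ = ⊥ := by
  rw [Submodule.disjoint_def] at hx hy
  refine (Submodule.eq_bot_iff _).2 fun v hv => ?_
  have hTv : T v ∈ S.eigenspace μ := End.mapsTo_genEigenspace_of_comm hST μ 1 hv
  refine hx v hv (End.mem_eigenspace_iff.2 (sub_eq_zero.1 ?_))
  refine hy _ (sub_mem hTv (Submodule.smul_mem _ x hv)) (End.mem_eigenspace_iff.2 ?_)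
  have := LinearMap.congr_fun hT v
  simp only [End.mul_apply, LinearMap.sub_apply, LinearMap.smul_apply, End.one_apply] at this
  rw [map_sub, map_smul, this]
  module

/-- Expand the relation for `A = B + C` and take commutators with `B`, using `[B, BC + CB] = [B², C]
= (b + b')[B, C]`. -/
lemma commute_of_quadratic {R : Type*} [Ring R] [Algebra ℂ R] {A B C : R} {a a' b b' : ℂ}
    (h : A = B + C) (hA : A * A = (a + a') • A - (a * a') • (1 : R))
    (hB : B * B = (b + b') • B - (b * b') • (1 : R)) :
    Commute B (C * C + (b + b' - a - a') • C) := by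
  obtain rfl : C = A - B := by rw [h]; abel
  rw [commute_iff_eq]
  simp only [mul_sub, sub_mul, mul_add, add_mul, mul_smul_comm, smul_mul_assoc, smul_sub, hA, hB]
  simp only [← mul_assoc, hB]
  simp only [mul_assoc, hB]
  simp only [mul_sub, sub_mul, mul_smul_comm, smul_mul_assoc, mul_one, one_mul]
  module

namespace IsDiagonalTriple

variable {U : Type*} [AddCommGroup U] [Module ℂ U] {r : ℕ} {A B C : End ℂ U}
  {s : TripleSpectrum 2 3 r}

lemma quadraticA (h : IsDiagonalTriple A B C s) :
    A * A = (s.a 0 + s.a 1) • A - (s.a 0 * s.a 1) • (1 : End ℂ U) := by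
  refine DiagonalizedBy.mul_self_eq (h.diagA.symm.le.trans (iSup_le fun i => ?_))
  fin_cases i
  exacts [le_sup_left, le_sup_right]

lemma quadraticB (h : IsDiagonalTriple A B C s) (h0 : B.eigenspace (s.b 0) = ⊥) :
    B * B = (s.b 1 + s.b 2) • B - (s.b 1 * s.b 2) • (1 : End ℂ U) := by
  refine DiagonalizedBy.mul_self_eq (h.diagB.symm.le.trans (iSup_le fun i => ?_))
  fin_cases i
  exacts [h0.le.trans bot_le, le_sup_left, le_sup_right]

/-- If the first eigenvalue of `B` does not occur and no linear form `q_{ij}` vanishes, then `B` and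
`C` commute. -/
lemma commute_of_eigenspace_eq_bot (h : IsDiagonalTriple A B C s)
    (h0 : B.eigenspace (s.b 0) = ⊥) (hq : ∀ i j, i ≠ j → SimpsonType.qForm s i j ≠ 0) :
    Commute B C := by
  have hA2 := h.quadraticA
  have hB2 := h.quadraticB h0
  have hcomm := commute_of_quadratic h.eq_add hA2 hB2
  set d := s.b 1 + s.b 2 - s.a 0 - s.a 1 with hd
  refine h.diagC.linearMap_ext fun i v hv => ?_
  suffices hw : B v ∈ C.eigenspace (s.c i) by
    rw [End.mem_eigenspace_iff] at hv hw
    rw [End.mul_apply, End.mul_apply, hw, hv, map_smul]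
  apply h.diagC.mem_eigenspace_of_sub_mem
  rw [End.mem_eigenspace_iff] at hv
  -- Since `B` commutes with `C² + dC`, applying `(C + c_i + d)(C - c_i)` to `B v` gives zero.
  set u := C (B v) - s.c i • B v with hu
  have hCu : C u = (-(s.c i + d)) • u := by
    have := LinearMap.congr_fun hcomm.eq v
    simp only [End.mul_apply, LinearMap.add_apply, LinearMap.smul_apply, hv, map_add,
      map_smul] at this
    rw [hu, map_sub, map_smul, eq_sub_of_add_eq this.symm]
    module
  by_cases hu0 : u = 0
  · rw [hu0]; exact zero_mem _
  obtain ⟨j, hj⟩ := h.diagC.exists_eq_of_hasEigenvalue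
    (End.hasEigenvalue_of_hasEigenvector ⟨End.mem_eigenspace_iff.2 hCu, hu0⟩)
  -- A nonzero `u` has eigenvalue `c_j = -(c_i + d)`, which is `q_{ij} = 0`; only `j = i` survives,
  -- and then diagonalizability of `C` rules out a Jordan block.
  obtain rfl : i = j := by
    by_contra hij
    refine hq i j hij ?_
    rw [SimpsonType.qForm, hj, hd]; ring
  exact End.mem_eigenspace_iff.2 (hj ▸ hCu)

lemma commute_A_B (h : IsDiagonalTriple A B C s) (h0 : B.eigenspace (s.b 0) = ⊥)
    (hq : ∀ i j, i ≠ j → SimpsonType.qForm s i j ≠ 0) : Commute A B := by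
  rw [h.eq_add]
  exact (Commute.refl B).add_left (h.commute_of_eigenspace_eq_bot h0 hq).symm

lemma finrank_eigenspaceA_eq_zero (h : IsDiagonalTriple A B C s)
    (h0 : B.eigenspace (s.b 0) = ⊥) (hq : ∀ i j, i ≠ j → SimpsonType.qForm s i j ≠ 0)
    (h1 : ∀ i, s.c i + s.b 1 - s.a 0 ≠ 0) (h2 : ∀ i, s.c i + s.b 2 - s.a 0 ≠ 0) :
    finrank ℂ (A.eigenspace (s.a 0)) = 0 := by
  rw [eigenspace_eq_bot_of_commute (h.commute_A_B h0 hq) (h.quadraticB h0)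
    (h.disjoint_eigenspace h1) (h.disjoint_eigenspace h2), finrank_bot]

lemma finrank_eigenspaceB_eq_zero (h : IsDiagonalTriple A B C s)
    (h0 : B.eigenspace (s.b 0) = ⊥) (hq : ∀ i j, i ≠ j → SimpsonType.qForm s i j ≠ 0)
    (h1 : ∀ i, s.c i + s.b 2 - s.a 0 ≠ 0) (h2 : ∀ i, s.c i + s.b 2 - s.a 1 ≠ 0) :
    finrank ℂ (B.eigenspace (s.b 2)) = 0 := by
  rw [eigenspace_eq_bot_of_commute (h.commute_A_B h0 hq).symm h.quadraticA
    (h.disjoint_eigenspace h1).symm (h.disjoint_eigenspace h2).symm, finrank_bot]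

end IsDiagonalTriple

/-! ### Irreducibility in the four cases. -/

namespace IsDiagonalTriple

section

variable {U : Type*} [AddCommGroup U] [Module ℂ U] [FiniteDimensional ℂ U] {A B C : End ℂ U}
  {W : Submodule ℂ U}

lemma _root_.Submodule.eq_bot_or_eq_top_of_finrank
    (h : 0 < finrank ℂ W → 0 < finrank ℂ (U ⧸ W) → False) : W = ⊥ ∨ W = ⊤ := by
  rcases Nat.eq_zero_or_pos (finrank ℂ W) with h0 | h0
  · exact .inl (Submodule.finrank_eq_zero.1 h0)
  rcases Nat.eq_zero_or_pos (finrank ℂ (U ⧸ W)) with h1 | h1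
  · refine .inr (Submodule.eq_top_of_finrank_eq ?_)
    rw [← W.finrank_quotient_add_finrank, h1, zero_add]
  · exact (h h0 h1).elim

theorem invariant_hypergeometric {m r : ℕ} {s : TripleSpectrum 2 m r} (h : IsDiagonalTriple A B C s)
    (hm : 0 < m) (hU : finrank ℂ U = m) (hx : finrank ℂ (A.eigenspace (s.a 1)) = m - 1)
    (hy : ∀ i, finrank ℂ (B.eigenspace (s.b i)) = 1)
    (hs : ∀ i j, s.b i + s.c j - s.a 1 ≠ 0)
    (hA : ∀ v ∈ W, A v ∈ W) (hB : ∀ v ∈ W, B v ∈ W) (hC : ∀ v ∈ W, C v ∈ W) :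
    W = ⊥ ∨ W = ⊤ := by
  refine Submodule.eq_bot_or_eq_top_of_finrank fun hW hQ => ?_
  obtain ⟨ex, ey, -⟩ := h.exists_finrank_eq_add hA hB hC
  have hn := W.finrank_quotient_add_finrank
  have hs' : ∀ i j, s.c j + s.b i - s.a 1 ≠ 0 := fun i j => by rw [add_comm]; exact hs i j
  have hR := h.restrict hA hB hC
  have hM := h.mapQ hA hB hC
  have ex := ex 1
  -- The bounds on `W` and on the quotient add up to `(m - 1) + 1 = m`, so both are sharp.
  have key : ∀ i, finrank ℂ (End.eigenspace (B.restrict hB) (s.b i)) =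
      finrank ℂ W - finrank ℂ (End.eigenspace (A.restrict hA) (s.a 1)) := fun i => by
    have := hR.finrank_add_le (hs' i)
    have := hM.finrank_add_le (hs' i)
    have := ey i
    have := hy i
    omega
  have hsum := hR.diagB.sum_finrank hR.injB
  simp only [key, Finset.sum_const, Finset.card_univ, Fintype.card_fin, smul_eq_mul] at hsum
  -- `dim W` is `m` times a constant independent of `i`, yet lies strictly between `0` and `m`.
  rcases Nat.eq_zero_or_pos
    (finrank ℂ W - finrank ℂ (End.eigenspace (A.restrict hA) (s.a 1))) with h0 | h0
  · rw [h0] at hsum; omega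
  · have := Nat.le_mul_of_pos_right m h0
    omega

theorem invariant_even {m r : ℕ} {s : TripleSpectrum 2 3 r} (h : IsDiagonalTriple A B C s)
    (hU : finrank ℂ U = 2 * m) (hx0 : finrank ℂ (A.eigenspace (s.a 0)) = m)
    (hx1 : finrank ℂ (A.eigenspace (s.a 1)) = m)
    (hy0 : finrank ℂ (B.eigenspace (s.b 0)) = 1) (hy2 : finrank ℂ (B.eigenspace (s.b 2)) = m)
    (hs : ∀ i, s.c i + s.b 2 - s.a 0 ≠ 0 ∧ s.c i + s.b 2 - s.a 1 ≠ 0)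
    (hq : ∀ i j, i ≠ j → SimpsonType.qForm s i j ≠ 0)
    (hA : ∀ v ∈ W, A v ∈ W) (hB : ∀ v ∈ W, B v ∈ W) (hC : ∀ v ∈ W, C v ∈ W) :
    W = ⊥ ∨ W = ⊤ := by
  refine Submodule.eq_bot_or_eq_top_of_finrank fun hW hQ => ?_
  obtain ⟨ex, ey, -⟩ := h.exists_finrank_eq_add hA hB hC
  have hn := W.finrank_quotient_add_finrank
  have hR := h.restrict hA hB hC
  have hM := h.mapQ hA hB hC
  have ex0 := ex 0
  have ex1 := ex 1
  have ey0 := ey 0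
  have ey2 := ey 2
  have sR := hR.diagA.sum_finrank hR.injA
  have sM := hM.diagA.sum_finrank hM.injA
  rw [Fin.sum_univ_two] at sR sM
  have := hR.finrank_add_le fun i => (hs i).1
  have := hR.finrank_add_le fun i => (hs i).2
  have := hM.finrank_add_le fun i => (hs i).1
  have := hM.finrank_add_le fun i => (hs i).2
  -- Sharp bounds make `a₁`, `a₂` and `b₃` each have half the dimension of either piece; the
  -- multiplicity of `b₁` is `1`, so one piece lacks it.
  have key : finrank ℂ (End.eigenspace (B.restrict hB) (s.b 0)) = 0 ∨
    finrank ℂ (End.eigenspace (W.mapQ W B hB) (s.b 0)) = 0 := by omega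
  rcases key with h0 | h0
  · have := hR.finrank_eigenspaceB_eq_zero (Submodule.finrank_eq_zero.1 h0) hq
      (fun i => (hs i).1) fun i => (hs i).2
    omega
  · have := hM.finrank_eigenspaceB_eq_zero (Submodule.finrank_eq_zero.1 h0) hq
      (fun i => (hs i).1) fun i => (hs i).2
    omega

theorem invariant_odd {m r : ℕ} {s : TripleSpectrum 2 3 r} (h : IsDiagonalTriple A B C s)
    (hU : finrank ℂ U = 2 * m + 1) (hx0 : finrank ℂ (A.eigenspace (s.a 0)) = m + 1)
    (hy0 : finrank ℂ (B.eigenspace (s.b 0)) = 1) (hy1 : finrank ℂ (B.eigenspace (s.b 1)) = m)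
    (hy2 : finrank ℂ (B.eigenspace (s.b 2)) = m)
    (hs : ∀ i, s.c i + s.b 2 - s.a 0 ≠ 0 ∧ s.c i + s.b 1 - s.a 0 ≠ 0)
    (hq : ∀ i j, i ≠ j → SimpsonType.qForm s i j ≠ 0)
    (hA : ∀ v ∈ W, A v ∈ W) (hB : ∀ v ∈ W, B v ∈ W) (hC : ∀ v ∈ W, C v ∈ W) :
    W = ⊥ ∨ W = ⊤ := by
  refine Submodule.eq_bot_or_eq_top_of_finrank fun hW hQ => ?_
  obtain ⟨ex, ey, -⟩ := h.exists_finrank_eq_add hA hB hC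
  have hn := W.finrank_quotient_add_finrank
  have hR := h.restrict hA hB hC
  have hM := h.mapQ hA hB hC
  have ex0 := ex 0
  have ey0 := ey 0
  have ey1 := ey 1
  have ey2 := ey 2
  have sR := hR.diagB.sum_finrank hR.injB
  have sM := hM.diagB.sum_finrank hM.injB
  rw [Fin.sum_univ_three] at sR sM
  have := hR.finrank_add_le fun i => (hs i).1
  have := hR.finrank_add_le fun i => (hs i).2
  have := hM.finrank_add_le fun i => (hs i).1
  have := hM.finrank_add_le fun i => (hs i).2
  -- On a piece without `b₁`, the sharp bounds give `b₂`, `b₃` and `a₁` each half the dimension, so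
  -- the `a₁`-eigenspace is nonzero.
  have key : finrank ℂ (End.eigenspace (B.restrict hB) (s.b 0)) = 0 ∨
    finrank ℂ (End.eigenspace (W.mapQ W B hB) (s.b 0)) = 0 := by omega
  rcases key with h0 | h0
  · have := hR.finrank_eigenspaceA_eq_zero (Submodule.finrank_eq_zero.1 h0) hq
      (fun i => (hs i).2) fun i => (hs i).1
    omega
  · have := hM.finrank_eigenspaceA_eq_zero (Submodule.finrank_eq_zero.1 h0) hq
      (fun i => (hs i).2) fun i => (hs i).1
    omega

lemma _root_.SimpsonType.sum_ne_half_of_card_eq_three {s : TripleSpectrum 2 3 6}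
    (hq : ∀ j k : Fin 6, 0 < j → j < k → SimpsonType.qFormExtra s 0 j k ≠ 0) {z : Fin 6 → ℕ}
    (hz : ∀ j, z j ≤ 1) (hz0 : z 0 = 1) (hsum : ∑ j, z j = 3) :
    ∑ j, (z j : ℂ) * s.c j ≠ (∑ l, s.c l) / 2 := by
  classical
  set S : Finset (Fin 6) := {j | z j = 1} with hS
  have hzS : ∀ j, z j = if j ∈ S then 1 else 0 := fun j => by
    have := hz j
    by_cases hj : z j = 1
    · simp [hS, hj]
    · simp only [hS, Finset.mem_filter_univ, hj, if_false]; omega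
  have h0 : (0 : Fin 6) ∈ S := by simp [hS, hz0]
  have hcard : (S.erase 0).card = 2 := by
    rw [Finset.card_erase_of_mem h0]
    have : ∑ j, z j = S.card := by
      rw [Finset.sum_congr rfl fun j _ => hzS j]; simp
    omega
  have hval : ∑ j, (z j : ℂ) * s.c j = s.c 0 + ∑ j ∈ S.erase 0, s.c j := by
    rw [Finset.add_sum_erase _ _ h0, Finset.sum_congr rfl fun j _ => by rw [hzS j]]
    simp
  obtain ⟨j, k, hjk, hSjk⟩ := Finset.card_eq_two.1 hcard
  have hj : 0 < j := Fin.pos_of_ne_zero (Finset.ne_of_mem_erase (hSjk ▸ by simp : j ∈ S.erase 0))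
  have hk : 0 < k := Fin.pos_of_ne_zero (Finset.ne_of_mem_erase (hSjk ▸ by simp : k ∈ S.erase 0))
  rw [hval, hSjk, Finset.sum_pair hjk]
  intro heq
  rcases lt_or_gt_of_ne hjk with hlt | hlt
  · exact hq j k hj hlt (by rw [SimpsonType.qFormExtra, ← heq]; ring)
  · exact hq k j hk hlt (by rw [SimpsonType.qFormExtra, ← heq]; ring)

/-- The multiplicities are `(2, 1)` for `A` and `(1, 1, 1)` for `B`, half of those on `V`. Comparing
traces, the three eigenvalues of `C` present sum to half of all six. -/
lemma false_of_finrank_eq_three {s : TripleSpectrum 2 3 6} (h : IsDiagonalTriple A B C s)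
    (htr : 4 * s.a 0 + 2 * s.a 1 = 2 * (s.b 0 + s.b 1 + s.b 2) + ∑ l, s.c l)
    (hq : ∀ j k : Fin 6, 0 < j → j < k → SimpsonType.qFormExtra s 0 j k ≠ 0)
    (hU : finrank ℂ U = 3)
    (hxy : ∀ i, finrank ℂ (A.eigenspace (s.a 0)) + finrank ℂ (B.eigenspace (s.b i)) = 3)
    (hz : ∀ j, finrank ℂ (C.eigenspace (s.c j)) ≤ 1)
    (hz0 : finrank ℂ (C.eigenspace (s.c 0)) = 1) : False := by
  refine SimpsonType.sum_ne_half_of_card_eq_three hq hz hz0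
    ((h.diagC.sum_finrank h.injC).trans hU) ?_
  have x := h.diagA.sum_finrank h.injA
  have y := h.diagB.sum_finrank h.injB
  have tr := h.trace_eq
  rw [Fin.sum_univ_three] at y
  rw [Fin.sum_univ_two] at x
  rw [Fin.sum_univ_two, Fin.sum_univ_three] at tr
  have h0 := hxy 0
  have h1 := hxy 1
  have h2 := hxy 2
  have e1 : finrank ℂ (A.eigenspace (s.a 0)) = 2 := by omega
  have e2 : finrank ℂ (A.eigenspace (s.a 1)) = 1 := by omega
  have e3 : ∀ i, finrank ℂ (B.eigenspace (s.b i)) = 1 := fun i => by have := hxy i; omega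
  rw [e1, e2, e3, e3, e3] at tr
  push_cast at tr
  linear_combination htr / 2 - tr

theorem invariant_extra {s : TripleSpectrum 2 3 6} (h : IsDiagonalTriple A B C s)
    (hU : finrank ℂ U = 6) (hx0 : finrank ℂ (A.eigenspace (s.a 0)) = 4)
    (hy : ∀ i, finrank ℂ (B.eigenspace (s.b i)) = 2)
    (hz : ∀ i, finrank ℂ (C.eigenspace (s.c i)) = 1)
    (htr : 4 * s.a 0 + 2 * s.a 1 = 2 * (s.b 0 + s.b 1 + s.b 2) + ∑ l, s.c l)
    (hs : ∀ i j, s.b i + s.c j - s.a 0 ≠ 0)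
    (hq : ∀ j k : Fin 6, 0 < j → j < k → SimpsonType.qFormExtra s 0 j k ≠ 0)
    (hA : ∀ v ∈ W, A v ∈ W) (hB : ∀ v ∈ W, B v ∈ W) (hC : ∀ v ∈ W, C v ∈ W) :
    W = ⊥ ∨ W = ⊤ := by
  refine Submodule.eq_bot_or_eq_top_of_finrank fun hW hQ => ?_
  obtain ⟨ex, ey, ez⟩ := h.exists_finrank_eq_add hA hB hC
  have hn := W.finrank_quotient_add_finrank
  have hs' : ∀ i j, s.c j + s.b i - s.a 0 ≠ 0 := fun i j => by rw [add_comm]; exact hs i j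
  have hR := h.restrict hA hB hC
  have hM := h.mapQ hA hB hC
  have ex0 := ex 0
  have hxy : ∀ i, finrank ℂ (End.eigenspace (A.restrict hA) (s.a 0)) +
        finrank ℂ (End.eigenspace (B.restrict hB) (s.b i)) = finrank ℂ W ∧
      finrank ℂ (End.eigenspace (W.mapQ W A hA) (s.a 0)) +
        finrank ℂ (End.eigenspace (W.mapQ W B hB) (s.b i)) = finrank ℂ (U ⧸ W) := fun i => by
    have := hR.finrank_add_le (hs' i)
    have := hM.finrank_add_le (hs' i)
    have := ey i
    have := hy i
    omega
  -- The three eigenspaces of `B` have equal dimension on each piece, so both dimensions are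
  -- positive multiples of `3` with sum `6`.
  have hWQ : finrank ℂ W = 3 ∧ finrank ℂ (U ⧸ W) = 3 := by
    have yR := hR.diagB.sum_finrank hR.injB
    have yM := hM.diagB.sum_finrank hM.injB
    rw [Fin.sum_univ_three] at yR yM
    have h0 := hxy 0
    have h1 := hxy 1
    have h2 := hxy 2
    clear hxy hs' hR hM ex ey ez
    omega
  have hz' := fun j => (ez j).symm.trans (hz j)
  -- The nonvanishing forms all contain `c₁`, so the trace argument goes to the piece where `c₁`
  -- occurs.
  rcases Nat.add_eq_one_iff.1 (hz' 0) with h0 | h0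
  · exact hM.false_of_finrank_eq_three htr hq hWQ.2 (fun i => (hxy i).2.trans hWQ.2)
      (fun j => (Nat.le_add_left _ _).trans (hz' j).le) h0.2
  · exact hR.false_of_finrank_eq_three htr hq hWQ.1 (fun i => (hxy i).1.trans hWQ.1)
      (fun j => (Nat.le_add_right _ _).trans (hz' j).le) h0.1

end

end IsDiagonalTriple

/-! ### Schur's lemma for self-adjoint forms. -/

section Schur

variable {V : Type*} [AddCommGroup V] [Module ℂ V] {A B C : End ℂ V}

lemma IsSelfAdjointForm.mapsTo_ker {f : LinearMap.BilinForm ℂ V} {T : End ℂ V}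
    (hf : ∀ v w, f (T v) w = f v (T w)) : ∀ v ∈ LinearMap.ker f, T v ∈ LinearMap.ker f := by
  intro v hv
  rw [LinearMap.mem_ker] at hv ⊢
  ext w
  rw [hf, hv]; rfl

theorem IsSelfAdjointForm.exists_eq_smul [FiniteDimensional ℂ V]
    (hirr : ∀ W : Submodule ℂ V, (∀ v ∈ W, A v ∈ W) → (∀ v ∈ W, B v ∈ W) → (∀ v ∈ W, C v ∈ W) →
      W = ⊥ ∨ W = ⊤)
    {f g : LinearMap.BilinForm ℂ V} (hf : IsSelfAdjointForm A B C f) (hf0 : f ≠ 0)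
    (hg : IsSelfAdjointForm A B C g) : ∃ k : ℂ, g = k • f := by
  obtain ⟨-, fA, fB, fC⟩ := hf
  obtain ⟨-, gA, gB, gC⟩ := hg
  have hker : LinearMap.ker f = ⊥ := (hirr _ (mapsTo_ker fA) (mapsTo_ker fB)
    (mapsTo_ker fC)).resolve_right fun h => hf0 (LinearMap.ker_eq_top.1 h)
  have : Nontrivial V := by
    by_contra hV
    rw [not_nontrivial_iff_subsingleton] at hV
    exact hf0 (Subsingleton.elim _ _)
  let φ : V ≃ₗ[ℂ] Dual ℂ V := LinearEquiv.ofInjectiveOfFinrankEq f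
    (LinearMap.ker_eq_bot.1 hker) Subspace.dual_finrank_eq.symm
  -- An eigenvector of `f⁻¹g` for `k` lies in the kernel of `g - k f`.
  obtain ⟨k, hk⟩ := End.exists_eigenvalue (φ.symm.toLinearMap ∘ₗ g : End ℂ V)
  obtain ⟨v, hv⟩ := hk.exists_hasEigenvector
  have hv' : (g - k • f) v = 0 := by
    have := congrArg φ hv.apply_eq_smul
    rw [LinearMap.comp_apply, LinearEquiv.coe_coe, LinearEquiv.apply_symm_apply, map_smul] at this
    rw [LinearMap.sub_apply, this]
    exact sub_self _
  have hsub : ∀ {T : End ℂ V}, (∀ v w, f (T v) w = f v (T w)) → (∀ v w, g (T v) w = g v (T w)) →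
      ∀ v w, (g - k • f) (T v) w = (g - k • f) v (T w) := fun h1 h2 v w => by
    simp [h1 v w, h2 v w]
  refine ⟨k, sub_eq_zero.1 (LinearMap.ker_eq_top.1 ((hirr _ (mapsTo_ker (hsub fA gA))
    (mapsTo_ker (hsub fB gB)) (mapsTo_ker (hsub fC gC))).resolve_left fun h => ?_))⟩
  exact hv.2 ((Submodule.eq_bot_iff _).1 h v (LinearMap.mem_ker.2 hv'))

end Schur

theorem mainTheorem3 {V : Type*} [AddCommGroup V] [Module ℂ V] [FiniteDimensional ℂ V]
    (t : SimpsonType) (A B C : Module.End ℂ V) (hABC : A = B + C)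
    (s : TripleSpectrum 2 t.lenB t.lenC)
    (hA : HasDiagonalSpectrum A t.typeA s.a)
    (hB : HasDiagonalSpectrum B t.typeB s.b)
    (hC : HasDiagonalSpectrum C t.typeC s.c)
    (hs : s ∈ t.genericSpectra)
    (f : LinearMap.BilinForm ℂ V) (hf : IsSelfAdjointForm A B C f) (hf0 : f ≠ 0)
    (g : LinearMap.BilinForm ℂ V) (hg : IsSelfAdjointForm A B C g) :
    ∃ k : ℂ, g = k • f := by
  obtain ⟨⟨iA, iB, iC, htr⟩, hav⟩ := hs
  have h : IsDiagonalTriple A B C s :=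
    ⟨hABC, hA.diagonalizedBy, hB.diagonalizedBy, hC.diagonalizedBy, iA, iB, iC⟩
  have xA := hA.finrank_eigenspace iA
  have xB := hB.finrank_eigenspace iB
  have xC := hC.finrank_eigenspace iC
  have hU : finrank ℂ V = t.lenC := by
    rw [← h.diagC.sum_finrank iC, Finset.sum_congr rfl fun j _ => xC j]
    exact (Finset.sum_const 1).trans (by simp)
  refine IsSelfAdjointForm.exists_eq_smul (fun W wA wB wC => ?_) hf hf0 hg
  cases t with
  | hypergeometric m hm =>
    exact h.invariant_hypergeometric (m := m) (two_pos.trans_le hm) hU (xA 1) xB hav wA wB wC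
  | even m hm =>
    exact h.invariant_even (m := m) hU (xA 0) (xA 1) (xB (0 : Fin 3)) (xB (2 : Fin 3)) hav.1 hav.2
      wA wB wC
  | odd m hm =>
    exact h.invariant_odd (m := m) hU (xA 0) (xB (0 : Fin 3)) (xB (1 : Fin 3)) (xB (2 : Fin 3))
      hav.1 hav.2 wA wB wC
  | extra =>
    have hy : ∀ i : Fin 3, SimpsonType.extra.typeB i = 2 := fun i => by fin_cases i <;> rfl
    -- The remaining goal is the trace condition with the multiplicities written out.
    refine h.invariant_extra hU (xA 0) (fun i => (xB i).trans (hy i)) xC ?_ hav.1 hav.2 wA wB wC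
    rw [Fin.sum_univ_two, show ∑ i, (SimpsonType.extra.typeB i : ℂ) * s.b i = _ from
      Fin.sum_univ_three (fun i : Fin 3 => (SimpsonType.extra.typeB i : ℂ) * s.b i)] at htr
    rw [hy, hy, hy] at htr
    simp only [SimpsonType.typeA, SimpsonType.typeC, Matrix.cons_val_zero, Matrix.cons_val_one] at htr
    push_cast at htr
    simp only [one_mul] at htr
    refine htr.trans ?_
    congr 1
    ring
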